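/- Let $\boldsymbol\pi\in\mathbb{R}^n$ be a probability vector with strictly positive entries, $\boldsymbol{\hat\pi}=\boldsymbol\pi^{1/2}$ (entrywise), $D_{\boldsymbol{\hat\pi}}=\operatorname{diag}(\boldsymbol{\hat\pi})$, and let $$\mathcal M_{\boldsymbol\pi}=\{S\in\mathbb{R}^{n\times n}: S>0 \text{ entrywise},\ S=S^\top,\ S\boldsymbol{\hat\pi}=\boldsymbol{\hat\pi}\},$$ a manifold with tangent spaces $\mathcal T_S\mathcal M_{\boldsymbol\pi}=\{\xi\in\mathbb{R}^{n\times n}:\xi=\xi^\top,\ \xi\boldsymbol{\hat\pi}=0\}$, endowed with the Fisher metric $\langle\xi,\eta\rangle_S=\sum_{i,j}\xi_{ij}\eta_{ij}/S_{ij}$. Let $\odot,\oslash$ be the entrywise product and division, let $\Pi_S$ be the projection of the symmetric matrices onto $\mathcal T_S\mathcal M_{\boldsymbol\pi}$ that is orthogonal for the inner product $\langle X,Y\rangle_S=\sum_{i,j}X_{ij}Y_{ij}/S_{ij}$ on symmetric matrices, and $\widetilde\Pi_S(Z)=\Pi_S\big(\tfrac{Z+Z^\top}{2}\big)$ for $Z\in\mathbb{R}^{n\times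 n}$. Let $f:\mathcal M_{\boldsymbol\pi}\to\mathbb{R}$ be the restriction of a $C^\infty$ function $F$ defined on an open subset of $\mathbb{R}^{n\times n}$ containing $\mathcal M_{\boldsymbol\pi}$. Let $\operatorname{Grad}f(S)$ be the gradient of $F$ at $S$ for the Frobenius inner product, $\operatorname{Hess}f(S)[\xi]$ the derivative of $\operatorname{Grad} F$ at $S$ in the direction $\xi$, $\operatorname{grad}f$ the Riemannian gradient of $f$, and $\operatorname{hess}f(S)[\xi]=\nabla_\xi\operatorname{grad}f(S)$ the Riemannian Hessian, $\nabla$ being the Levi-Civita connection of the Fisher metric (which exists). For a map $g$ defined on $\mathcal M_{\boldsymbol\pi}$, $\mathrm D g(S)[\xi]$ denotes its derivative at $S$ along $\xi\in\mathcal T_S\mathcal M_{\boldsymbol\pi}$. For a matrix $X$ let $\mathcal A(X)=\operatorname{diag}(XD_{\boldsymbol{\hat\pi}}\boldsymbol{\hat\pi})+D_{\boldsymbol{\hat\pi}}XD_{\boldsymbol{\hat\pi}}$. Then for every $S\in\mathcal M_{\boldsymbol\pi}$ and $\xi\in\mathcal T_S\mathcal M_{\boldsymbol\pi}$: $$\operatorname{hess}f(S)[\xi]=\widetilde\Pi_S\big(\mathrm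 D(\operatorname{grad}f)(S)[\xi]\big)-\tfrac12\,\widetilde\Pi_S\Big(\big(\widetilde\Pi_S(\operatorname{Grad}f(S)\odot S)\odot\xi\big)\oslash S\Big).$$ Moreover, put $\gamma(S)=\operatorname{Grad}f(S)\odot S$. The matrix $\mathcal A(S)$ is nonsingular; let $\boldsymbol\alpha=\boldsymbol\alpha(S)$ be the solution of $$\mathcal A(S)\,\boldsymbol\alpha=\tfrac{\gamma+\gamma^\top}{2}\,\boldsymbol{\hat\pi}.$$ The maps $\gamma$, $\boldsymbol\alpha$ and $\operatorname{grad}f$ are differentiable on $\mathcal M_{\boldsymbol\pi}$, and with $\dot\gamma=\mathrm D\gamma(S)[\xi]$ and $\dot{\boldsymbol\alpha}=\mathrm D\boldsymbol\alpha(S)[\xi]$ one has $$\dot\gamma=\operatorname{Hess}f(S)[\xi]\odot S+\operatorname{Grad}f(S)\odot\xi,$$ $$\mathcal A(S)\,\dot{\boldsymbol\alpha}=\tfrac{\dot\gamma+\dot\gamma^\top}{2}\,\boldsymbol{\hat\pi}-\mathcal A(\xi)\,\boldsymbol\alpha,$$ $$\mathrm D(\operatorname{grad}f)(S)[\xi]=\tfrac{\dot\gamma+\dot\gamma^\top}{2}-(\dot{\boldsymbol\alpha}\boldsymbol{\hat\pi}^\top+\boldsymbol{\hat\pi}\dot{\boldsymbol\alpha}^\top)\odot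 S-(\boldsymbol\alpha\boldsymbol{\hat\pi}^\top+\boldsymbol{\hat\pi}\boldsymbol\alpha^\top)\odot\xi.$$ In the term $\widetilde\Pi_S(\mathrm D(\operatorname{grad}f)(S)[\xi])$ of the Hessian the symmetrization may be dropped: $$\widetilde\Pi_S\big(\mathrm D(\operatorname{grad}f)(S)[\xi]\big)=\widetilde\Pi_S\big(\dot\gamma-(\dot{\boldsymbol\alpha}\boldsymbol{\hat\pi}^\top+\boldsymbol{\hat\pi}\dot{\boldsymbol\alpha}^\top)\odot S-(\boldsymbol\alpha\boldsymbol{\hat\pi}^\top+\boldsymbol{\hat\pi}\boldsymbol\alpha^\top)\odot\xi\big).$$ -/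

import Mathlib

set_option maxSynthPendingDepth 3

open scoped Manifold ContDiff Bundle

noncomputable section

namespace ReversibleManifold

/-- Real `n × n` matrices, as a normed space (the sup norm is only used as some norm inducing the
usual topology of this finite dimensional space). On `Mat n` the operations `*` and `/` are the
*entrywise* (Hadamard) product and division; `Matrix.of X` is `X` as a `Matrix`, with the matrix
product. -/
abbrev Mat (n : ℕ) : Type := Fin n → Fin n → ℝ

variable {n : ℕ}

/-- The transpose. -/
def tr (X : Mat n) : Mat n := fun i j => X j i

/-- The symmetric part `(X + Xᵀ) / 2`. -/
def symPart (X : Mat n) : Mat n := (1 / 2 : ℝ) • (X + tr X)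

/-- The action of a matrix on a vector. -/
def mulV (X : Mat n) (v : Fin n → ℝ) : Fin n → ℝ := (Matrix.of X).mulVec v

lemma mulV_apply (X : Mat n) (v : Fin n → ℝ) (i : Fin n) : mulV X v i = ∑ j, X i j * v j := rfl

lemma mulV_add (X Y : Mat n) (v : Fin n → ℝ) : mulV (X + Y) v = mulV X v + mulV Y v := by
  funext i; simp [mulV_apply, add_mul, Finset.sum_add_distrib]

lemma mulV_sub (X Y : Mat n) (v : Fin n → ℝ) : mulV (X - Y) v = mulV X v - mulV Y v := by
  funext i; simp [mulV_apply, sub_mul, Finset.sum_sub_distrib]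

lemma mulV_smul (c : ℝ) (X : Mat n) (v : Fin n → ℝ) : mulV (c • X) v = c • mulV X v := by
  funext i; simp [mulV_apply, mul_assoc, Finset.mul_sum]

/-- Probability vectors with strictly positive entries. -/
structure PosProb (n : ℕ) where
  val : Fin n → ℝ
  pos : ∀ i, 0 < val i
  sum_eq_one : ∑ i, val i = 1

/-- The entrywise square root `π̂` of `π`. -/
def hatPi (p : PosProb n) : Fin n → ℝ := fun i => √(p.val i)

/-! ### The manifold -/

/-- The set `M_π` of entrywise positive symmetric matrices `S` with `S π̂ = π̂`. -/
structure RevMan (p : PosProb n) where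
  mat : Mat n
  pos : ∀ i j, 0 < mat i j
  symm : tr mat = mat
  eig : mulV mat (hatPi p) = hatPi p

instance (p : PosProb n) : TopologicalSpace (RevMan p) :=
  TopologicalSpace.induced RevMan.mat inferInstance

/-- The space of symmetric matrices `ξ` with `ξ π̂ = 0`. -/
def tangentModel (p : PosProb n) : Submodule ℝ (Mat n) where
  carrier := {ξ | tr ξ = ξ ∧ mulV ξ (hatPi p) = 0}
  add_mem' := by
    rintro a b ⟨ha, ha'⟩ ⟨hb, hb'⟩
    refine ⟨?_, ?_⟩
    · conv_rhs => rw [← ha, ← hb]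
      rfl
    · rw [mulV_add, ha', hb', add_zero]
  zero_mem' := ⟨rfl, by funext i; simp [mulV_apply]⟩
  smul_mem' := by
    rintro c a ⟨ha, ha'⟩
    refine ⟨?_, ?_⟩
    · conv_rhs => rw [← ha]
      rfl
    · rw [mulV_smul, ha', smul_zero]

lemma hatPi_pos (p : PosProb n) (i : Fin n) : 0 < hatPi p i := Real.sqrt_pos.2 (p.pos i)

/-- The base point `π̂ π̂ᵀ` of `M_π`. -/
def basePt (p : PosProb n) : RevMan p where
  mat := fun i j => hatPi p i * hatPi p j
  pos := fun i j => mul_pos (hatPi_pos p i) (hatPi_pos p j)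
  symm := by funext i j; simp [tr, mul_comm]
  eig := by
    have h : ∑ i, hatPi p i * hatPi p i = 1 := by
      rw [← p.sum_eq_one]
      exact Finset.sum_congr rfl fun i _ => Real.mul_self_sqrt (p.pos i).le
    funext i
    simp only [mulV_apply, mul_assoc]
    rw [← Finset.mul_sum, h, mul_one]

instance (p : PosProb n) : Nonempty (RevMan p) := ⟨basePt p⟩

/-- The space `tangentModel p` with its norm; `M_π` is modelled on it. -/
def TModel (p : PosProb n) : Type := tangentModel p

instance (p : PosProb n) : NormedAddCommGroup (TModel p) :=
  inferInstanceAs (NormedAddCommGroup (tangentModel p))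

instance (p : PosProb n) : NormedSpace ℝ (TModel p) :=
  inferInstanceAs (NormedSpace ℝ (tangentModel p))

instance (p : PosProb n) : FiniteDimensional ℝ (TModel p) :=
  inferInstanceAs (FiniteDimensional ℝ (tangentModel p))

/-- The inclusion of `TModel p` into the matrices. -/
def TModel.incl (p : PosProb n) : TModel p →L[ℝ] Mat n := (tangentModel p).subtypeL

/-- The global chart `S ↦ S - π̂ π̂ᵀ` of `M_π`, with values in an open set of `tangentModel p`. -/
def globalChart (p : PosProb n) (S : RevMan p) : TModel p :=
  ⟨S.mat - (basePt p).mat, by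
    refine ⟨?_, ?_⟩
    · conv_rhs => rw [← S.symm, ← (basePt p).symm]
      rfl
    · rw [mulV_sub, S.eig, (basePt p).eig, sub_self]⟩

lemma isEmbedding_mat (p : PosProb n) : Topology.IsEmbedding (RevMan.mat (p := p)) :=
  ⟨⟨rfl⟩, fun S T h => by cases S; cases T; cases h; rfl⟩

lemma isOpenEmbedding_globalChart (p : PosProb n) :
    Topology.IsOpenEmbedding (globalChart p) := by
  have hemb : Topology.IsEmbedding (globalChart p) := by
    have h1 : Topology.IsEmbedding (fun S : RevMan p => S.mat - (basePt p).mat) :=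
      (Homeomorph.subRight (basePt p).mat).isEmbedding.comp (isEmbedding_mat p)
    have h2 : Topology.IsEmbedding (Subtype.val : TModel p → Mat n) :=
      Topology.IsEmbedding.subtypeVal
    exact (h2.of_comp_iff).1 h1
  refine ⟨hemb, ?_⟩
  have : Set.range (globalChart p) =
      ⋂ i : Fin n, ⋂ j : Fin n,
        {ξ : TModel p | 0 < ξ.1 i j + (basePt p).mat i j} := by
    ext ξ
    simp only [Set.mem_range, Set.mem_iInter, Set.mem_ofPred_eq]
    constructor
    · rintro ⟨S, rfl⟩ i j
      simpa [globalChart] using S.pos i j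
    · intro h
      refine ⟨⟨ξ.1 + (basePt p).mat, fun i j => h i j, ?_, ?_⟩, ?_⟩
      · conv_rhs => rw [← ξ.2.1, ← (basePt p).symm]
        rfl
      · rw [mulV_add, ξ.2.2, (basePt p).eig, zero_add]
      · apply Subtype.ext
        simp [globalChart]
  rw [this]
  refine isOpen_iInter_of_finite fun i => isOpen_iInter_of_finite fun j => ?_
  refine isOpen_lt continuous_const (Continuous.add ?_ continuous_const)
  exact (continuous_apply j).comp ((continuous_apply i).comp continuous_subtype_val)

instance (p : PosProb n) : ChartedSpace (TModel p) (RevMan p) :=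
  (isOpenEmbedding_globalChart p).singletonChartedSpace

instance (p : PosProb n) (k : ℕ∞ω) : IsManifold 𝓘(ℝ, TModel p) k (RevMan p) :=
  (isOpenEmbedding_globalChart p).isManifold_singleton

/-- The tangent space of `M_π` at `S`. -/
abbrev TSpace {p : PosProb n} (S : RevMan p) : Type :=
  TangentSpace 𝓘(ℝ, TModel p) S

/-- A tangent vector as a matrix. -/
def tmat {p : PosProb n} {S : RevMan p} : TSpace S →L[ℝ] Mat n :=
  (TModel.incl p)

/-- The identification `tmat` is the differential of the inclusion of `M_π` into the matrices. -/
lemma hasMFDerivAt_mat {p : PosProb n} (S : RevMan p) :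
    HasMFDerivAt 𝓘(ℝ, TModel p) 𝓘(ℝ, Mat n) RevMan.mat S (tmat : TSpace S →L[ℝ] Mat n) := by
  refine ⟨(isEmbedding_mat p).continuous.continuousAt, ?_⟩
  have h : HasFDerivAt (fun ξ : TModel p => ξ.1 + (basePt p).mat)
      (TModel.incl p) (extChartAt 𝓘(ℝ, TModel p) S S) :=
    (TModel.incl p).hasFDerivAt.add_const _
  refine (h.congr_of_eventuallyEq ?_).hasFDerivWithinAt
  have ht : (extChartAt 𝓘(ℝ, TModel p) S).target ∈
      nhds (extChartAt 𝓘(ℝ, TModel p) S S) := extChartAt_target_mem_nhds S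
  filter_upwards [ht] with ξ hξ
  have h2 : globalChart p ((extChartAt 𝓘(ℝ, TModel p) S).symm ξ) = ξ :=
    (extChartAt 𝓘(ℝ, TModel p) S).right_inv hξ
  have h3 := congrArg Subtype.val h2
  simp only [globalChart] at h3
  simp only [writtenInExtChartAt, Function.comp_apply, extChartAt_model_space_eq_id,
    PartialEquiv.refl_coe, id_eq]
  rw [← h3]
  abel

lemma contMDiff_mat (p : PosProb n) (k : ℕ∞ω) :
    ContMDiff 𝓘(ℝ, TModel p) 𝓘(ℝ, Mat n) k (RevMan.mat (p := p)) := by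
  have h1 : ContMDiff 𝓘(ℝ, TModel p) 𝓘(ℝ, TModel p) k (globalChart p) :=
    contMDiff_isOpenEmbedding (isOpenEmbedding_globalChart p)
  have h2 : ContDiff ℝ k (fun ξ : TModel p => ξ.1 + (basePt p).mat) :=
    (TModel.incl p).contDiff.add contDiff_const
  have h3 := h2.contMDiff.comp h1
  refine h3.congr fun S => ?_
  simp [globalChart]

lemma mem_chart_source' {p : PosProb n} (S T : RevMan p) : T ∈ (chartAt (TModel p) S).source :=
  mem_chart_source (TModel p) T

lemma symmL_trivializationAt {p : PosProb n} (S T : RevMan p) (v : TModel p) :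
    (trivializationAt (TModel p) (TangentSpace 𝓘(ℝ, TModel p)) S).symmL ℝ T v = v := by
  rw [TangentBundle.symmL_trivializationAt_eq_core (mem_chart_source' S T)]
  exact (tangentBundleCore 𝓘(ℝ, TModel p) (RevMan p)).coordChange_self (achart (TModel p) T) T
    (mem_chart_source' T T) v

/-! ### The Fisher metric -/

/-- The bilinear form `(X, Y) ↦ ∑ i j, X i j * Y i j / S i j`. -/
def fisherForm (S : Mat n) : Mat n →L[ℝ] Mat n →L[ℝ] ℝ :=
  LinearMap.toContinuousLinearMap
    ((LinearMap.toContinuousLinearMap : (Mat n →ₗ[ℝ] ℝ) ≃ₗ[ℝ] (Mat n →L[ℝ] ℝ)).toLinearMap ∘ₗ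
      LinearMap.mk₂ ℝ (fun X Y : Mat n => ∑ i, ∑ j, X i j * Y i j / S i j)
        (fun X X' Y => by simp [add_mul, add_div, Finset.sum_add_distrib])
        (fun c X Y => by simp [mul_assoc, mul_div_assoc, Finset.mul_sum])
        (fun X Y Y' => by simp [mul_add, add_div, Finset.sum_add_distrib])
        (fun c X Y => by simp [mul_left_comm, mul_div_assoc, Finset.mul_sum]))

lemma fisherForm_apply (S X Y : Mat n) :
    fisherForm S X Y = ∑ i, ∑ j, X i j * Y i j / S i j := rfl

/-- The restriction of `fisherForm S` to the tangent space. -/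
def tangentForm (p : PosProb n) (S : Mat n) : TModel p →L[ℝ] TModel p →L[ℝ] ℝ :=
  (fisherForm S).bilinearComp (TModel.incl p) (TModel.incl p)

lemma contDiffAt_tangentForm (p : PosProb n) (k : ℕ∞ω) {X : Mat n} (hX : ∀ i j, X i j ≠ 0) :
    ContDiffAt ℝ k (tangentForm p) X := by
  have h : tangentForm p = fun X => ∑ i, ∑ j, (X i j)⁻¹ •
      tangentForm p (fun a b => if a = i ∧ b = j then 1 else 0) := by
    funext X
    ext Y Z
    simp only [tangentForm, ContinuousLinearMap.bilinearComp_apply, fisherForm_apply, FunLike.coe_sum, Finset.sum_apply,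
      FunLike.coe_smul, Pi.smul_apply, smul_eq_mul]
    refine Finset.sum_congr rfl fun i _ => Finset.sum_congr rfl fun j _ => ?_
    rw [Finset.sum_eq_single i, Finset.sum_eq_single j]
    · simp [div_eq_mul_inv, mul_comm]
    · intro b _ hb; simp [hb]
    · simp
    · intro a _ ha; simp [ha]
    · simp
  rw [h]
  refine ContDiffAt.sum fun i _ => ContDiffAt.sum fun j _ => ?_
  have hc : ContDiffAt ℝ k (fun X : Mat n => X i j) X :=
    ((ContinuousLinearMap.proj (R := ℝ) (φ := fun _ : Fin n => ℝ) j).comp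
      (ContinuousLinearMap.proj (R := ℝ) (φ := fun _ : Fin n => Fin n → ℝ) i)).contDiff.contDiffAt
  exact (ContinuousLinearMap.toSpanSingleton ℝ
    (tangentForm p (fun a b => if a = i ∧ b = j then 1 else 0))).contDiff.contDiffAt.comp X
      (hc.inv (hX i j))

/-- The Fisher inner product on the tangent space at `S`. -/
def fisherInner {p : PosProb n} (S : RevMan p) : TSpace S →L[ℝ] TSpace S →L[ℝ] ℝ :=
  tangentForm p S.mat

/-- The Fisher metric on `M_π`: `⟨ξ, η⟩_S = ∑ i j, ξ i j * η i j / S i j`. -/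
def fisherMetric (p : PosProb n) :
    Bundle.ContMDiffRiemannianMetric 𝓘(ℝ, TModel p) ∞ (TModel p)
      (fun S : RevMan p => TSpace S) where
  inner S := fisherInner S
  symm S ξ η := by
    change fisherForm S.mat (tmat ξ) (tmat η) = fisherForm S.mat (tmat η) (tmat ξ)
    simp [fisherForm_apply, mul_comm]
  pos S ξ hξ := by
    change 0 < fisherForm S.mat (tmat ξ) (tmat ξ)
    have hne : tmat ξ ≠ 0 := fun h => hξ (Subtype.ext h)
    obtain ⟨i, hi⟩ := Function.ne_iff.1 hne
    obtain ⟨j, hj⟩ := Function.ne_iff.1 hi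
    rw [fisherForm_apply]
    have hnn : ∀ i j, 0 ≤ tmat ξ i j * tmat ξ i j / S.mat i j := fun i j =>
      div_nonneg (mul_self_nonneg _) (S.pos i j).le
    refine Finset.sum_pos' (fun i _ => Finset.sum_nonneg fun j _ => hnn i j) ⟨i, Finset.mem_univ _, ?_⟩
    refine Finset.sum_pos' (fun j _ => hnn i j) ⟨j, Finset.mem_univ _, ?_⟩
    exact div_pos (mul_self_pos.2 hj) (S.pos i j)
  isVonNBounded S := by
    change Bornology.IsVonNBounded ℝ
      {ξ : TModel p | fisherForm S.mat ξ.1 ξ.1 < 1}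
    rw [NormedSpace.isVonNBounded_iff, isBounded_iff_forall_norm_le]
    refine ⟨1 + ‖S.mat‖, fun ξ hξ => ?_⟩
    rw [Set.mem_ofPred_eq, fisherForm_apply] at hξ
    have hnn : ∀ i j, 0 ≤ ξ.1 i j * ξ.1 i j / S.mat i j := fun i j =>
      div_nonneg (mul_self_nonneg _) (S.pos i j).le
    have h0 : (0 : ℝ) ≤ 1 + ‖S.mat‖ := by positivity
    change ‖ξ.1‖ ≤ _
    refine (pi_norm_le_iff_of_nonneg h0).2 fun i => (pi_norm_le_iff_of_nonneg h0).2 fun j => ?_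
    have h1 : ξ.1 i j * ξ.1 i j / S.mat i j < 1 :=
      ((Finset.single_le_sum (fun j _ => hnn i j) (Finset.mem_univ j)).trans
        (Finset.single_le_sum (f := fun i => ∑ j, ξ.1 i j * ξ.1 i j / S.mat i j)
          (fun i _ => Finset.sum_nonneg fun j _ => hnn i j) (Finset.mem_univ i))).trans_lt hξ
    rw [div_lt_one (S.pos i j)] at h1
    have h2 : S.mat i j ≤ ‖S.mat‖ :=
      ((le_abs_self _).trans (norm_le_pi_norm (S.mat i) j)).trans (norm_le_pi_norm S.mat i)
    rw [Real.norm_eq_abs]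
    nlinarith [abs_mul_abs_self (ξ.1 i j), abs_nonneg (ξ.1 i j)]
  contMDiff := by
    intro S
    rw [Bundle.contMDiffAt_section]
    have h := (contDiffAt_tangentForm p ∞ (fun i j => (S.pos i j).ne')).contMDiffAt.comp S
      ((contMDiff_mat p ∞) S)
    convert! h using 1
    funext T
    ext v w
    rw [hom_trivializationAt_apply]
    have hT : T ∈ (trivializationAt (TModel p) (TangentSpace 𝓘(ℝ, TModel p)) S).baseSet :=
      mem_chart_source' S T
    dsimp only
    rw [inCoordinates_apply_eq₂ hT hT (Set.mem_univ _)]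
    have hsymm : ∀ u : TModel p,
        (trivializationAt (TModel p) (TangentSpace 𝓘(ℝ, TModel p)) S).symm T u = u := fun u => by
      have h1 := symmL_trivializationAt S T u
      rw [Bundle.Trivialization.symmL_apply] at h1
      · exact h1
      · exact hT
    rw [hsymm, hsymm]
    exact congrArg (fun L : ℝ →ₗ[ℝ] ℝ => L (tangentForm p T.mat v w))
      (Bundle.Trivial.linearMapAt_trivialization ℝ (RevMan p) ℝ T)

instance (p : PosProb n) : Bundle.RiemannianBundle (fun S : RevMan p => TSpace S) :=
  ⟨(fisherMetric p).toRiemannianMetric⟩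

lemma inner_eq {p : PosProb n} {S : RevMan p} (ξ η : TSpace S) :
    inner ℝ ξ η = ∑ i, ∑ j, tmat ξ i j * tmat η i j / S.mat i j := rfl

/-- Levi-Civita connections on `M_π` with the Fisher metric: torsion-free connections on the tangent
bundle that are compatible with the metric. In `CovariantDerivative`, `conn V S ξ` is `∇_ξ V` at `S`
(for a vector field `V` differentiable at `S`). -/
def IsLeviCivita {p : PosProb n}
    (conn : CovariantDerivative 𝓘(ℝ, TModel p) (TModel p) (fun S : RevMan p => TSpace S)) : Prop :=
  conn.torsion = 0 ∧ conn.IsMetricCompatible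

/-- The directional derivative along `ξ` of a map defined on `M_π` with values in a normed space. -/
def dirDeriv {p : PosProb n} {W : Type} [NormedAddCommGroup W] [NormedSpace ℝ W]
    (g : RevMan p → W) (S : RevMan p) (ξ : TSpace S) : W :=
  mvfderiv 𝓘(ℝ, TModel p) g S ξ

instance {p : PosProb n} (S : RevMan p) : FiniteDimensional ℝ (TSpace S) :=
  inferInstanceAs (FiniteDimensional ℝ (TModel p))

/-- The tangent vector representing a linear form on the tangent space through the Fisher metric. -/
def fisherDual {p : PosProb n} {S : RevMan p} (φ : TSpace S →L[ℝ] ℝ) : TSpace S :=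
  haveI : CompleteSpace (TSpace S) := FiniteDimensional.complete ℝ (TSpace S)
  (InnerProductSpace.toDual ℝ (TSpace S)).symm φ

lemma inner_fisherDual {p : PosProb n} {S : RevMan p} (φ : TSpace S →L[ℝ] ℝ) (η : TSpace S) :
    inner ℝ (fisherDual φ) η = φ η := by
  have : CompleteSpace (TSpace S) := FiniteDimensional.complete ℝ (TSpace S)
  exact InnerProductSpace.toDual_symm_apply

/-- The Riemannian gradient of `f` on `M_π`: `⟨grad f S, ξ⟩_S = D f(S)[ξ]`. -/
def riemGrad {p : PosProb n} (f : RevMan p → ℝ) (S : RevMan p) : TSpace S :=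
  fisherDual (mvfderiv 𝓘(ℝ, TModel p) f S)

/-- The Riemannian Hessian `hess f(S)[ξ] = ∇_ξ grad f (S)`, for a connection `∇` on `M_π` (which will
be a Levi-Civita connection). -/
def riemHess {p : PosProb n}
    (conn : CovariantDerivative 𝓘(ℝ, TModel p) (TModel p) (fun S : RevMan p => TSpace S))
    (f : RevMan p → ℝ) (S : RevMan p) : TSpace S →L[ℝ] TSpace S :=
  conn (riemGrad f) S

/-- `fisherProj S Z` is the tangent vector with `⟨fisherProj S Z, η⟩_S = ∑ i j, Z i j * η i j / S i j`
for every tangent `η`: the orthogonal projection of `Z` onto the tangent space. -/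
def fisherProj {p : PosProb n} (S : RevMan p) (Z : Mat n) : TSpace S :=
  fisherDual ((fisherForm S.mat Z).comp tmat)

/-- The orthogonal projection with respect to the Fisher metric is characterised by
`Z - fisherProj S Z ⟂ T_S M_π`. -/
lemma fisherProj_spec {p : PosProb n} (S : RevMan p) (Z : Mat n) (η : TSpace S) :
    ∑ i, ∑ j, (Z i j - tmat (fisherProj S Z) i j) * tmat η i j / S.mat i j = 0 := by
  have h : inner ℝ (fisherProj S Z) η = fisherForm S.mat Z (tmat η) := inner_fisherDual _ η
  rw [inner_eq, fisherForm_apply] at h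
  simp only [sub_mul, sub_div, Finset.sum_sub_distrib]
  rw [h, sub_self]

/-- `Π̃_S(Z) = Π_S((Z + Zᵀ) / 2)`. -/
def projTilde {p : PosProb n} (S : RevMan p) (Z : Mat n) : TSpace S :=
  fisherProj S (symPart Z)

/-- The Euclidean gradient (for the Frobenius inner product) of a function of a matrix. -/
def euclGrad (F : Mat n → ℝ) (X : Mat n) : Mat n := fun i j =>
  fderiv ℝ F X (Pi.single i (Pi.single j 1))

lemma euclGrad_spec (F : Mat n → ℝ) (X V : Mat n) :
    ∑ i, ∑ j, euclGrad F X i j * V i j = fderiv ℝ F X V := by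
  have hV : V = ∑ i, ∑ j, V i j • (Pi.single i (Pi.single j 1) : Mat n) := by
    funext a b
    simp only [Finset.sum_apply, Pi.smul_apply, smul_eq_mul]
    rw [Finset.sum_eq_single a, Finset.sum_eq_single b]
    · simp
    · intro j _ hj; simp [Pi.single_eq_of_ne hj.symm]
    · simp
    · intro i _ hi; simp [Pi.single_eq_of_ne hi.symm]
    · simp
  conv_rhs => rw [hV]
  simp [euclGrad, mul_comm]

/-- The Euclidean Hessian along a direction: the derivative of the Euclidean gradient. -/
def euclHess (F : Mat n → ℝ) (X V : Mat n) : Mat n := fderiv ℝ (euclGrad F) X V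

/-- `diag(X D_π̂ π̂) + D_π̂ X D_π̂`; at `X = S` this is the matrix `𝒜`. -/
def sysMat (p : PosProb n) (X : Mat n) : Matrix (Fin n) (Fin n) ℝ :=
  Matrix.diagonal ((Matrix.of X * Matrix.diagonal (hatPi p)).mulVec (hatPi p)) +
    Matrix.diagonal (hatPi p) * Matrix.of X * Matrix.diagonal (hatPi p)

/-- `a π̂ᵀ + π̂ aᵀ`. -/
def outerSym (p : PosProb n) (a : Fin n → ℝ) : Mat n := fun i j =>
  a i * hatPi p j + hatPi p i * a j

/-- `γ(S) = Grad F(S) ⊙ S`. -/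
def gam {p : PosProb n} (F : Mat n → ℝ) (S : RevMan p) : Mat n := euclGrad F S.mat * S.mat

end ReversibleManifold

end

/-!
The global chart `S ↦ S - π̂ π̂ᵀ` is a translation, so it identifies every tangent space of `M_π`
with the fixed space `TModel p`, vector fields with maps `M_π → TModel p`
(`mdifferentiableAt_section_iff`) and the differential `mderiv` of a vector-valued map with a
Fréchet derivative in the chart. In these terms the Lie bracket is the difference of two directional
derivatives (`mlieBracket_eq`).

*Levi-Civita connection.* Differentiating `∑ i j, σ i j * τ i j / S i j` along `ξ` gives, besides
the two terms of the product rule, `-∑ i j, σ i j * ξ i j * τ i j / S i j ^ 2` (`mvfderiv_inner`).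
This last form is symmetric in `σ, ξ, τ`, so the Koszul formula yields the Christoffel tensor
`-½ Π_S ((σ ⊙ ξ) ⊘ S)`. The flat derivative corrected by this tensor is torsion-free and metric
(`isLeviCivita_fisherConn`), and any other Levi-Civita connection agrees with it on differentiable
fields: the difference is a tensor symmetric in one pair of arguments and skew in another
(`IsLeviCivita.eq_fisherConn`).

*Gradient.* Since `⟨Grad F ⊙ S, η⟩_S = ∑ i j, Grad F i j * η i j`, the Riemannian gradient is
`Π_S (Grad F ⊙ S)` (`riemGrad_eq`). The matrices `(a π̂ᵀ + π̂ aᵀ) ⊙ S` are orthogonal to the tangent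
space, and subtracting one of them from a symmetric matrix makes it tangent exactly when `a` solves
the system with matrix `sysMat p S` (`tmat_fisherProj`). That system is nonsingular because its
quadratic form is `½ ∑ i j, S i j * (a i * π̂ j + π̂ i * a j) ^ 2` (`isUnit_det_sysMat`).

Differentiating the system and the formula `grad f = sym γ - (α π̂ᵀ + π̂ αᵀ) ⊙ S` gives the
identities for `α` and `grad f`; inserting `grad f` into the connection gives the Hessian.
-/

noncomputable section

namespace ReversibleManifold

variable {n : ℕ}

/-! ### Calculus in the global chart -/

/-- The inverse of the global chart; outside the (open) range of the chart its values are junk. -/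
def chartInv (p : PosProb n) : TModel p → RevMan p :=
  ((isOpenEmbedding_globalChart p).toOpenPartialHomeomorph (globalChart p)).symm

lemma extChartAt_eq_globalChart {p : PosProb n} (S : RevMan p) :
    ⇑(extChartAt 𝓘(ℝ, TModel p) S) = globalChart p := rfl

lemma extChartAt_symm_eq_chartInv {p : PosProb n} (S : RevMan p) :
    ⇑(extChartAt 𝓘(ℝ, TModel p) S).symm = chartInv p := rfl

lemma chartInv_globalChart {p : PosProb n} (S : RevMan p) : chartInv p (globalChart p S) = S :=
  extChartAt_to_inv (I := 𝓘(ℝ, TModel p)) S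

lemma eventually_globalChart_chartInv {p : PosProb n} (S : RevMan p) :
    ∀ᶠ v in nhds (globalChart p S), globalChart p (chartInv p v) = v := by
  filter_upwards [extChartAt_target_mem_nhds (I := 𝓘(ℝ, TModel p)) S] with v hv
  exact (extChartAt 𝓘(ℝ, TModel p) S).right_inv hv

/-- Differentiability on `M_π` is differentiability of the map read in the global chart. Continuity
at `S`, part of the left-hand side, comes for free because the chart is global. -/
lemma hasMFDerivAt_iff_hasFDerivAt {p : PosProb n} {W : Type*} [NormedAddCommGroup W]
    [NormedSpace ℝ W] {g : RevMan p → W} {S : RevMan p} {L : TModel p →L[ℝ] W} :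
    HasMFDerivAt 𝓘(ℝ, TModel p) 𝓘(ℝ, W) g S L ↔
      HasFDerivAt (g ∘ chartInv p) L (globalChart p S) := by
  have h1 : HasMFDerivAt 𝓘(ℝ, TModel p) 𝓘(ℝ, W) g S L ↔
      ContinuousAt g S ∧ HasFDerivWithinAt (g ∘ chartInv p) L
        (Set.range (id : TModel p → TModel p)) (globalChart p S) := Iff.rfl
  rw [h1, Set.range_id, hasFDerivWithinAt_univ]
  refine ⟨And.right, fun h => ⟨?_, h⟩⟩
  have h2 := h.continuousAt.comp (isOpenEmbedding_globalChart p).continuous.continuousAt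
  refine h2.congr (.of_forall fun T => ?_)
  simp [chartInv_globalChart]

lemma mdifferentiableAt_iff_differentiableAt {p : PosProb n} {W : Type*} [NormedAddCommGroup W]
    [NormedSpace ℝ W] {g : RevMan p → W} {S : RevMan p} :
    MDifferentiableAt 𝓘(ℝ, TModel p) 𝓘(ℝ, W) g S ↔
      DifferentiableAt ℝ (g ∘ chartInv p) (globalChart p S) :=
  ⟨fun h => (hasMFDerivAt_iff_hasFDerivAt.1 h.hasMFDerivAt).differentiableAt,
    fun h => (hasMFDerivAt_iff_hasFDerivAt.2 h.hasFDerivAt).mdifferentiableAt⟩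

/-- The differential at `S` of a vector-valued map on `M_π`, with `TModel p` in place of the
(definitionally equal) tangent space as its domain, so that the Fréchet calculus applies to it. -/
def mderiv {p : PosProb n} {W : Type*} [NormedAddCommGroup W] [NormedSpace ℝ W]
    (g : RevMan p → W) (S : RevMan p) : TModel p →L[ℝ] W :=
  mvfderiv 𝓘(ℝ, TModel p) g S

lemma hasFDerivAt_mderiv {p : PosProb n} {W : Type*} [NormedAddCommGroup W]
    [NormedSpace ℝ W] {g : RevMan p → W} {S : RevMan p}
    (h : MDifferentiableAt 𝓘(ℝ, TModel p) 𝓘(ℝ, W) g S) :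
    HasFDerivAt (g ∘ chartInv p) (mderiv g S) (globalChart p S) :=
  hasMFDerivAt_iff_hasFDerivAt.1 h.hasMFDerivAt

lemma mderiv_eq {p : PosProb n} {W : Type*} [NormedAddCommGroup W]
    [NormedSpace ℝ W] {g : RevMan p → W} {S : RevMan p} {L : TModel p →L[ℝ] W}
    (h : HasFDerivAt (g ∘ chartInv p) L (globalChart p S)) :
    mderiv g S = L :=
  (hasMFDerivAt_iff_hasFDerivAt.2 h).mfderiv

/-- A vector field on `M_π` as a map into `TModel p`, to which every tangent space is definitionally
equal. -/
def sect {p : PosProb n} (V : ∀ S : RevMan p, TSpace S) : RevMan p → TModel p := V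

/-- The preferred trivializations of the tangent bundle are the identity on fibres, so a field is
differentiable as a section if and only if it is differentiable as a map into `TModel p`. -/
lemma mdifferentiableAt_section_iff {p : PosProb n} {V : ∀ S : RevMan p, TSpace S} {S : RevMan p} :
    MDifferentiableAt 𝓘(ℝ, TModel p) (𝓘(ℝ, TModel p).prod 𝓘(ℝ, TModel p))
      (fun T => (⟨T, V T⟩ : TangentBundle 𝓘(ℝ, TModel p) (RevMan p))) S ↔
    MDifferentiableAt 𝓘(ℝ, TModel p) 𝓘(ℝ, TModel p) (sect V) S := by
  have h : (fun T => (trivializationAt (TModel p) (TangentSpace 𝓘(ℝ, TModel p)) S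
      (⟨T, V T⟩ : TangentBundle 𝓘(ℝ, TModel p) (RevMan p))).2) = sect V := by
    funext T
    have hT : T ∈ (trivializationAt (TModel p) (TangentSpace 𝓘(ℝ, TModel p)) S).baseSet :=
      mem_chart_source' S T
    have h1 := symmL_trivializationAt S T (V T)
    have h2 := Bundle.Trivialization.continuousLinearMapAt_symmL (R := ℝ)
      (trivializationAt (TModel p) (TangentSpace 𝓘(ℝ, TModel p)) S) hT (V T)
    rw [h1, Bundle.Trivialization.continuousLinearMapAt_apply_of_mem (R := ℝ) (hb := hT)] at h2
    exact h2
  rw [mdifferentiableAt_section, h]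

lemma hasMFDerivAt_globalChart {p : PosProb n} (S : RevMan p) :
    HasMFDerivAt 𝓘(ℝ, TModel p) 𝓘(ℝ, TModel p) (globalChart p) S
      (ContinuousLinearMap.id ℝ (TModel p)) := by
  rw [hasMFDerivAt_iff_hasFDerivAt]
  exact (hasFDerivAt_id _).congr_of_eventuallyEq (eventually_globalChart_chartInv S)

lemma mfderivWithin_chartInv {p : PosProb n} (S : RevMan p) :
    ∀ᶠ v in nhds (globalChart p S),
      mfderivWithin 𝓘(ℝ, TModel p) 𝓘(ℝ, TModel p) (chartInv p) (Set.range 𝓘(ℝ, TModel p)) v =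
        ContinuousLinearMap.id ℝ (TModel p) := by
  have h0 : (extChartAt 𝓘(ℝ, TModel p) S).target ∈ nhds (globalChart p S) :=
    extChartAt_target_mem_nhds (I := 𝓘(ℝ, TModel p)) S
  filter_upwards [h0] with v hv
  have h := mfderiv_extChartAt_comp_mfderivWithin_extChartAt_symm (I := 𝓘(ℝ, TModel p)) hv
  rw [extChartAt_symm_eq_chartInv, extChartAt_eq_globalChart,
    (hasMFDerivAt_globalChart _).mfderiv] at h
  exact h

/-- In the global chart the Lie bracket is `[V, W] = DW[V] - DV[W]`. -/
lemma mlieBracket_eq {p : PosProb n} (V W : ∀ S : RevMan p, TSpace S) (S : RevMan p)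
    (hV : MDifferentiableAt 𝓘(ℝ, TModel p) 𝓘(ℝ, TModel p) (sect V) S)
    (hW : MDifferentiableAt 𝓘(ℝ, TModel p) 𝓘(ℝ, TModel p) (sect W) S) :
    VectorField.mlieBracket 𝓘(ℝ, TModel p) V W S =
      mderiv (sect W) S (sect V S) - mderiv (sect V) S (sect W S) := by
  -- The differentials of the chart and of its inverse are the identity: pulling back does nothing.
  have key : ∀ V : (∀ S : RevMan p, TSpace S),
      VectorField.mpullbackWithin 𝓘(ℝ, TModel p) 𝓘(ℝ, TModel p) (extChartAt 𝓘(ℝ, TModel p) S).symm V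
        (Set.range 𝓘(ℝ, TModel p)) =ᶠ[nhds (globalChart p S)] (sect V ∘ chartInv p) := by
    intro V
    filter_upwards [mfderivWithin_chartInv S] with v hv
    rw [extChartAt_symm_eq_chartInv, VectorField.mpullbackWithin_apply, hv]
    exact congrArg (fun L : TModel p →L[ℝ] TModel p => L (V (chartInv p v)))
      ContinuousLinearMap.inverse_id
  have hbracket : ∀ (V' W' : TModel p → TModel p) (s : Set (TModel p)),
      V' =ᶠ[nhds (globalChart p S)] sect V ∘ chartInv p →
      W' =ᶠ[nhds (globalChart p S)] sect W ∘ chartInv p → s = Set.univ →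
      VectorField.lieBracketWithin ℝ V' W' s (globalChart p S) =
        mderiv (sect W) S (sect V S) - mderiv (sect V) S (sect W S) := by
    rintro V' W' s hV' hW' rfl
    have hb := Filter.EventuallyEq.lieBracket_vectorField_eq (𝕜 := ℝ) hV' hW'
    rw [VectorField.lieBracketWithin_univ, hb, VectorField.lieBracket_eq]
    dsimp only
    rw [(hasFDerivAt_mderiv hV).fderiv, (hasFDerivAt_mderiv hW).fderiv]
    simp only [Function.comp_apply, chartInv_globalChart]
  rw [← VectorField.mlieBracketWithin_univ, VectorField.mlieBracketWithin_apply,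
    extChartAt_eq_globalChart, (hasMFDerivAt_globalChart S).mfderiv]
  have hs : (extChartAt 𝓘(ℝ, TModel p) S).symm ⁻¹' Set.univ ∩ Set.range 𝓘(ℝ, TModel p) =
      Set.univ := by simp
  refine Eq.trans ?_ (hbracket _ _ _ (key V) (key W) hs)
  exact congrArg (fun L : TModel p →L[ℝ] TModel p => L _) ContinuousLinearMap.inverse_id

/-! ### The Fisher projection -/

lemma inner_eq_fisherForm {p : PosProb n} {S : RevMan p} (ξ η : TSpace S) :
    inner ℝ ξ η = fisherForm S.mat (tmat ξ) (tmat η) := rfl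

lemma inner_fisherProj {p : PosProb n} (S : RevMan p) (Z : Mat n) (η : TSpace S) :
    inner ℝ (fisherProj S Z) η = fisherForm S.mat Z (tmat η) := inner_fisherDual _ η

lemma fisherProj_eq_iff {p : PosProb n} {S : RevMan p} {Z : Mat n} {ξ : TSpace S} :
    fisherProj S Z = ξ ↔
      ∀ η : TSpace S, fisherForm S.mat Z (tmat η) = fisherForm S.mat (tmat ξ) (tmat η) := by
  constructor
  · rintro rfl η
    rw [← inner_fisherProj]; rfl
  · intro h
    refine ext_inner_right ℝ fun η => ?_
    rw [inner_fisherProj, h]; rfl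

lemma fisherProj_tmat {p : PosProb n} {S : RevMan p} (ξ : TSpace S) :
    fisherProj S (tmat ξ) = ξ :=
  fisherProj_eq_iff.2 fun _ => rfl

lemma fisherProj_add {p : PosProb n} (S : RevMan p) (Y Z : Mat n) :
    fisherProj S (Y + Z) = fisherProj S Y + fisherProj S Z :=
  ext_inner_right ℝ fun η => by
    rw [inner_add_left, inner_fisherProj, inner_fisherProj, inner_fisherProj, map_add]; rfl

lemma fisherProj_smul {p : PosProb n} (S : RevMan p) (c : ℝ) (Z : Mat n) :
    fisherProj S (c • Z) = c • fisherProj S Z :=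
  ext_inner_right ℝ fun η => by
    rw [inner_smul_left, inner_fisherProj, inner_fisherProj, map_smul]; rfl

/-- A symmetric tangent vector at a symmetric base point does not see the skew part of `Z`. -/
lemma fisherForm_symPart {p : PosProb n} (S : RevMan p) (Z : Mat n) (η : TSpace S) :
    fisherForm S.mat (symPart Z) (tmat η) = fisherForm S.mat Z (tmat η) := by
  have hS : ∀ i j, S.mat j i = S.mat i j := fun i j => congrFun (congrFun S.symm i) j
  have hη : ∀ i j, tmat η j i = tmat η i j := fun i j => congrFun (congrFun (Subtype.prop η).1 i) j
  have htr : fisherForm S.mat (tr Z) (tmat η) = fisherForm S.mat Z (tmat η) := by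
    rw [fisherForm_apply, fisherForm_apply, Finset.sum_comm]
    refine Finset.sum_congr rfl fun i _ => Finset.sum_congr rfl fun j _ => ?_
    rw [hS i j, hη i j, tr]
  rw [symPart, map_smul, map_add]
  simp only [FunLike.coe_smul, Pi.smul_apply, FunLike.coe_add, Pi.add_apply, htr, smul_eq_mul]
  ring

lemma projTilde_eq_fisherProj {p : PosProb n} (S : RevMan p) (Z : Mat n) :
    projTilde S Z = fisherProj S Z :=
  ext_inner_right ℝ fun η => by
    rw [projTilde, inner_fisherProj, inner_fisherProj, fisherForm_symPart]

/-! ### The Levi-Civita connection -/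

lemma mat_add_div (X Y Z : Mat n) : (X + Y) / Z = X / Z + Y / Z := by
  funext i j; simp [_root_.add_div]

/-- The Christoffel tensor `(σ, ξ) ↦ -½ Π_S ((σ ⊙ ξ) ⊘ S)` of the Fisher metric in the global
chart. -/
def christoffel {p : PosProb n} (S : RevMan p) : TSpace S →L[ℝ] TSpace S →L[ℝ] TSpace S :=
  LinearMap.toContinuousLinearMap
    ((LinearMap.toContinuousLinearMap :
      (TSpace S →ₗ[ℝ] TSpace S) ≃ₗ[ℝ] (TSpace S →L[ℝ] TSpace S)).toLinearMap ∘ₗ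
      LinearMap.mk₂ ℝ (fun σ ξ : TSpace S =>
          -(1 / 2 : ℝ) • fisherProj S (tmat σ * tmat ξ / S.mat))
        (fun σ σ' ξ => by
          rw [map_add, add_mul, mat_add_div, fisherProj_add, smul_add])
        (fun c σ ξ => by
          rw [map_smul, smul_mul_assoc, smul_div_assoc, fisherProj_smul, smul_comm])
        (fun σ ξ ξ' => by
          rw [map_add, mul_add, mat_add_div, fisherProj_add, smul_add])
        (fun c σ ξ => by
          rw [map_smul, mul_smul_comm, smul_div_assoc, fisherProj_smul, smul_comm]))

lemma christoffel_apply {p : PosProb n} (S : RevMan p) (σ ξ : TSpace S) :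
    christoffel S σ ξ = -(1 / 2 : ℝ) • fisherProj S (tmat σ * tmat ξ / S.mat) := rfl

lemma christoffel_comm {p : PosProb n} (S : RevMan p) (σ ξ : TSpace S) :
    christoffel S σ ξ = christoffel S ξ σ := by
  rw [christoffel_apply, christoffel_apply, mul_comm]

/-- The flat connection of the global chart: `∇_ξ σ` is the directional derivative of `σ`
along `ξ`. -/
def flatConn (p : PosProb n) :
    CovariantDerivative 𝓘(ℝ, TModel p) (TModel p) (fun S : RevMan p => TSpace S) where
  toFun σ S := mderiv (sect σ) S
  isCovariantDerivativeOnUniv :=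
    { add := by
        intro σ τ S hσ hτ _
        have h := (hasFDerivAt_mderiv (mdifferentiableAt_section_iff.1 hσ)).add
          (hasFDerivAt_mderiv (mdifferentiableAt_section_iff.1 hτ))
        exact mderiv_eq h
      leibniz := by
        intro σ g S hσ hg _
        have h := (hasFDerivAt_mderiv hg).smul
          (hasFDerivAt_mderiv (mdifferentiableAt_section_iff.1 hσ))
        refine (mderiv_eq h).trans ?_
        simp only [Function.comp_apply, chartInv_globalChart]
        rfl }

/-- The flat connection corrected by the Christoffel tensor. -/
def fisherConn (p : PosProb n) :
    CovariantDerivative 𝓘(ℝ, TModel p) (TModel p) (fun S : RevMan p => TSpace S) where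
  toFun σ S := flatConn p σ S + christoffel S (σ S)
  isCovariantDerivativeOnUniv := (flatConn p).isCovariantDerivativeOnUniv.add_one_form christoffel

lemma fisherConn_apply {p : PosProb n} (σ : ∀ S : RevMan p, TSpace S) (S : RevMan p)
    (ξ : TSpace S) :
    fisherConn p σ S ξ = flatConn p σ S ξ + christoffel S (σ S) ξ := rfl

lemma hasFDerivAt_mat_chartInv {p : PosProb n} (S : RevMan p) :
    HasFDerivAt (RevMan.mat ∘ chartInv p) (TModel.incl p) (globalChart p S) :=
  hasMFDerivAt_iff_hasFDerivAt.1 (hasMFDerivAt_mat S)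

lemma hasFDerivAt_entry {E : Type*} [NormedAddCommGroup E] [NormedSpace ℝ E] {g : E → Mat n}
    {g' : E →L[ℝ] Mat n} {x : E} (h : HasFDerivAt g g' x) (i j : Fin n) :
    HasFDerivAt (fun v => g v i j)
      ((ContinuousLinearMap.proj (R := ℝ) (φ := fun _ : Fin n => ℝ) j).comp
        ((ContinuousLinearMap.proj (R := ℝ) (φ := fun _ : Fin n => Fin n → ℝ) i).comp g')) x :=
  hasFDerivAt_pi'.1 (hasFDerivAt_pi'.1 h i) j

/-- The derivative of `∑ i j, a i j * b i j / c i j` when all three matrices vary. -/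
lemma exists_hasFDerivAt_fisherForm {E : Type*} [NormedAddCommGroup E] [NormedSpace ℝ E]
    {a b c : E → Mat n} {a' b' c' : E →L[ℝ] Mat n} {x : E} (ha : HasFDerivAt a a' x)
    (hb : HasFDerivAt b b' x) (hc : HasFDerivAt c c' x) (hne : ∀ i j, c x i j ≠ 0) :
    ∃ L : E →L[ℝ] ℝ, HasFDerivAt (fun v => fisherForm (c v) (a v) (b v)) L x ∧
      ∀ v, L v = fisherForm (c x) (a' v) (b x) + fisherForm (c x) (a x) (b' v) -
        fisherForm (c x) (a x * c' v / c x) (b x) := by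
  have h := HasFDerivAt.fun_sum (u := Finset.univ) fun i _ =>
    HasFDerivAt.fun_sum (u := Finset.univ) fun j _ =>
      ((hasFDerivAt_entry ha i j).fun_mul (hasFDerivAt_entry hb i j)).fun_mul
        ((hasDerivAt_inv (hne i j)).comp_hasFDerivAt x (hasFDerivAt_entry hc i j))
  refine ⟨_, h, fun v => ?_⟩
  simp only [fisherForm_apply, ← Finset.sum_add_distrib, ← Finset.sum_sub_distrib,
    FunLike.coe_sum, Finset.sum_apply]
  refine Finset.sum_congr rfl fun i _ => Finset.sum_congr rfl fun j _ => ?_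
  have := hne i j
  simp
  field_simp
  ring

/-- The derivative of the Fisher inner product of two fields. The last term, coming from the
variation of the base point, is what the Christoffel tensor compensates. -/
lemma mvfderiv_inner {p : PosProb n} {σ τ : ∀ S : RevMan p, TSpace S} {S : RevMan p}
    (hσ : MDifferentiableAt 𝓘(ℝ, TModel p) 𝓘(ℝ, TModel p) (sect σ) S)
    (hτ : MDifferentiableAt 𝓘(ℝ, TModel p) 𝓘(ℝ, TModel p) (sect τ) S) (ξ : TSpace S) :
    mvfderiv 𝓘(ℝ, TModel p) (fun T => inner ℝ (σ T) (τ T)) S ξ =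
      fisherForm S.mat (tmat (flatConn p σ S ξ)) (tmat (τ S)) +
      fisherForm S.mat (tmat (σ S)) (tmat (flatConn p τ S ξ)) -
      fisherForm S.mat (tmat (σ S) * tmat ξ / S.mat) (tmat (τ S)) := by
  obtain ⟨L, hL, hL'⟩ := exists_hasFDerivAt_fisherForm
    ((TModel.incl p).hasFDerivAt.comp _ (hasFDerivAt_mderiv hσ))
    ((TModel.incl p).hasFDerivAt.comp _ (hasFDerivAt_mderiv hτ)) (hasFDerivAt_mat_chartInv S)
    (fun i j => (chartInv p (globalChart p S)).pos i j |>.ne')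
  have h : mderiv (fun T : RevMan p => (inner ℝ (σ T) (τ T) : ℝ)) S = L := mderiv_eq hL
  refine (congrArg (fun L : TModel p →L[ℝ] ℝ => L ξ) h).trans ((hL' ξ).trans ?_)
  simp only [Function.comp_apply, chartInv_globalChart]
  rfl

lemma inner_christoffel {p : PosProb n} (S : RevMan p) (σ ξ τ : TSpace S) :
    inner ℝ (christoffel S σ ξ) τ =
      -(1 / 2 : ℝ) * fisherForm S.mat (tmat σ * tmat ξ / S.mat) (tmat τ) := by
  rw [christoffel_apply, inner_smul_left, inner_fisherProj]; rfl

/-- `∑ i j, X i j * Y i j * Z i j / S i j ^ 2` is symmetric in `X` and `Z`. -/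
lemma fisherForm_mul_div (S X Y Z : Mat n) :
    fisherForm S (X * Y / S) Z = fisherForm S (Z * Y / S) X := by
  simp only [fisherForm_apply]
  refine Finset.sum_congr rfl fun i _ => Finset.sum_congr rfl fun j _ => ?_
  simp; ring

theorem isLeviCivita_fisherConn (p : PosProb n) : IsLeviCivita (fisherConn p) := by
  constructor
  · rw [CovariantDerivative.torsion_eq_zero_iff]
    intro X Y S hX hY
    rw [mlieBracket_eq X Y S (mdifferentiableAt_section_iff.1 hX)
      (mdifferentiableAt_section_iff.1 hY), fisherConn_apply, fisherConn_apply,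
      christoffel_comm S (X S), add_sub_add_right_eq_sub]
    rfl
  · rw [CovariantDerivative.isMetricCompatible_iff]
    intro S X σ τ _ hσ hτ
    beta_reduce
    rw [mvfderiv_inner (mdifferentiableAt_section_iff.1 hσ)
      (mdifferentiableAt_section_iff.1 hτ), fisherConn_apply, fisherConn_apply, inner_add_left,
      inner_add_right, inner_christoffel, real_inner_comm (christoffel S (τ S) (X S)),
      inner_christoffel, fisherForm_mul_div S.mat (tmat (τ S)), inner_eq_fisherForm,
      inner_eq_fisherForm]
    ring

lemma mdifferentiableAt_constSection {p : PosProb n} (v : TModel p) (S : RevMan p) :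
    MDifferentiableAt 𝓘(ℝ, TModel p) (𝓘(ℝ, TModel p).prod 𝓘(ℝ, TModel p))
      (fun T => (⟨T, v⟩ : TangentBundle 𝓘(ℝ, TModel p) (RevMan p))) S :=
  mdifferentiableAt_section_iff.2 mdifferentiableAt_const

/-- Uniqueness of the Levi-Civita connection, at fields differentiable at the point; elsewhere a
`CovariantDerivative` is unconstrained. -/
theorem IsLeviCivita.eq_fisherConn {p : PosProb n}
    {conn : CovariantDerivative 𝓘(ℝ, TModel p) (TModel p) (fun S : RevMan p => TSpace S)}
    (h : IsLeviCivita conn) {σ : ∀ S : RevMan p, TSpace S} {S : RevMan p}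
    (hσ : MDifferentiableAt 𝓘(ℝ, TModel p) (𝓘(ℝ, TModel p).prod 𝓘(ℝ, TModel p))
      (fun T => (⟨T, σ T⟩ : TangentBundle 𝓘(ℝ, TModel p) (RevMan p))) S) :
    conn σ S = fisherConn p σ S := by
  have h' := isLeviCivita_fisherConn p
  set D : TSpace S →L[ℝ] TSpace S →L[ℝ] TSpace S :=
    conn.isCovariantDerivativeOnUniv.difference (fisherConn p).isCovariantDerivativeOnUniv S
  have hD : ∀ {τ : ∀ S : RevMan p, TSpace S},
      MDifferentiableAt 𝓘(ℝ, TModel p) (𝓘(ℝ, TModel p).prod 𝓘(ℝ, TModel p))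
        (fun T => (⟨T, τ T⟩ : TangentBundle 𝓘(ℝ, TModel p) (RevMan p))) S →
      D (τ S) = conn τ S - fisherConn p τ S := fun hτ =>
    conn.isCovariantDerivativeOnUniv.difference_apply
      (fisherConn p).isCovariantDerivativeOnUniv (Set.mem_univ S) hτ
  -- Both connections are torsion-free, so their difference tensor is symmetric.
  have hsymm : ∀ x y : TSpace S, D x y = D y x := by
    intro x y
    have hx := mdifferentiableAt_constSection (p := p) x S
    have hy := mdifferentiableAt_constSection (p := p) y S
    have h1 := (CovariantDerivative.torsion_eq_zero_iff _).1 h.1 hx hy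
    have h2 := (CovariantDerivative.torsion_eq_zero_iff _).1 h'.1 hx hy
    have e1 := congrArg (fun L : TSpace S →L[ℝ] TSpace S => L y) (hD hx)
    have e2 := congrArg (fun L : TSpace S →L[ℝ] TSpace S => L x) (hD hy)
    refine e1.trans (Eq.trans ?_ e2.symm)
    rw [← h2] at h1
    change conn (fun _ => x) S y - fisherConn p (fun _ => x) S y =
      conn (fun _ => y) S x - fisherConn p (fun _ => y) S x
    rw [sub_eq_sub_iff_add_eq_add] at h1 ⊢
    exact (add_comm _ _).trans h1.symm
  -- Both connections are metric, so `⟨D x z, y⟩` is skew in `x` and `y`.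
  have hskew : ∀ x y z : TSpace S, inner ℝ (D x z) y = - inner ℝ (D y z) x := by
    intro x y z
    have hx := mdifferentiableAt_constSection (p := p) x S
    have hy := mdifferentiableAt_constSection (p := p) y S
    have h1 := h.2.mvfderiv_inner_eq (fun _ => z) hx hy
    have h2 := h'.2.mvfderiv_inner_eq (fun _ => z) hx hy
    have e1 := congrArg (fun L : TSpace S →L[ℝ] TSpace S => L z) (hD hx)
    have e2 := congrArg (fun L : TSpace S →L[ℝ] TSpace S => L z) (hD hy)
    have e1' : D x z = conn (fun _ => x) S z - fisherConn p (fun _ => x) S z := e1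
    have e2' : D y z = conn (fun _ => y) S z - fisherConn p (fun _ => y) S z := e2
    rw [h1] at h2
    beta_reduce at h2
    rw [e1', e2', inner_sub_left, inner_sub_left, real_inner_comm x, real_inner_comm x]
    linarith
  -- A trilinear form symmetric in one pair of arguments and skew in another vanishes.
  have hzero : ∀ x z : TSpace S, D x z = 0 := by
    intro x z
    refine ext_inner_right ℝ fun y => ?_
    rw [inner_zero_left]
    have e1 := hskew x y z
    have e2 := hskew z x y
    have e3 := hskew y z x
    rw [hsymm x y] at *
    rw [hsymm z x, hsymm z y] at *
    linarith
  have := hD hσ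
  rw [← sub_eq_zero, ← this]
  ext z
  exact hzero _ _

/-! ### The linear system -/

lemma sysMat_mulVec_apply (p : PosProb n) (X : Mat n) (a : Fin n → ℝ) (i : Fin n) :
    (sysMat p X).mulVec a i =
      ∑ j, (a i * hatPi p j + hatPi p i * a j) * X i j * hatPi p j := by
  rw [sysMat, Matrix.add_mulVec, Pi.add_apply, Matrix.mulVec_diagonal, ← Matrix.mulVec_mulVec,
    ← Matrix.mulVec_mulVec, ← Matrix.mulVec_mulVec, Matrix.mulVec_diagonal]
  simp only [Matrix.mulVec, dotProduct, Matrix.of_apply, Matrix.diagonal_apply, ite_mul, zero_mul,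
    Finset.sum_ite_eq, Finset.mem_univ, if_true, Finset.sum_mul, Finset.mul_sum,
    ← Finset.sum_add_distrib]
  refine Finset.sum_congr rfl fun j _ => ?_
  ring

/-- The system matrix sends `a` to `((a π̂ᵀ + π̂ aᵀ) ⊙ X) π̂`, so solving the system prescribes the
action on `π̂` of the correction `(a π̂ᵀ + π̂ aᵀ) ⊙ X`. -/
lemma sysMat_mulVec (p : PosProb n) (X : Mat n) (a : Fin n → ℝ) :
    (sysMat p X).mulVec a = mulV (outerSym p a * X) (hatPi p) := by
  funext i
  rw [sysMat_mulVec_apply]; rfl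

/-- The quadratic form of the system matrix is a weighted sum of squares. -/
lemma dotProduct_sysMat_mulVec {p : PosProb n} (S : RevMan p) (a : Fin n → ℝ) :
    2 * (a ⬝ᵥ (sysMat p S.mat).mulVec a) =
      ∑ i, ∑ j, S.mat i j * (a i * hatPi p j + hatPi p i * a j) ^ 2 := by
  have hS : ∀ i j, S.mat j i = S.mat i j := fun i j => congrFun (congrFun S.symm i) j
  have h : a ⬝ᵥ (sysMat p S.mat).mulVec a =
      ∑ i, ∑ j, a i * ((a i * hatPi p j + hatPi p i * a j) * S.mat i j * hatPi p j) := by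
    simp only [dotProduct, sysMat_mulVec_apply, Finset.mul_sum]
  rw [two_mul, h]
  conv_lhs => enter [2]; rw [Finset.sum_comm]
  rw [← Finset.sum_add_distrib]
  refine Finset.sum_congr rfl fun i _ => ?_
  rw [← Finset.sum_add_distrib]
  refine Finset.sum_congr rfl fun j _ => ?_
  rw [hS i j]
  ring

lemma isUnit_det_sysMat {p : PosProb n} (S : RevMan p) : IsUnit (sysMat p S.mat).det := by
  rw [isUnit_iff_ne_zero]
  intro hdet
  obtain ⟨a, ha, h⟩ := Matrix.exists_mulVec_eq_zero_iff.2 hdet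
  have h0 := dotProduct_sysMat_mulVec S a
  rw [h, dotProduct_zero, mul_zero] at h0
  have hnn : ∀ i j, 0 ≤ S.mat i j * (a i * hatPi p j + hatPi p i * a j) ^ 2 := fun i j =>
    mul_nonneg (S.pos i j).le (sq_nonneg _)
  refine ha (funext fun i => ?_)
  have h1 := (Finset.sum_eq_zero_iff_of_nonneg fun i _ => Finset.sum_nonneg fun j _ => hnn i j).1
    h0.symm i (Finset.mem_univ i)
  have h2 := (Finset.sum_eq_zero_iff_of_nonneg fun j _ => hnn i j).1 h1 i (Finset.mem_univ i)
  -- The diagonal terms `S i i * (2 * π̂ i * a i) ^ 2` already determine `a`.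
  have h3 := (mul_eq_zero.1 h2).resolve_left (S.pos i i).ne'
  have h4 : 2 * hatPi p i * a i = 0 := by linear_combination pow_eq_zero_iff two_ne_zero |>.1 h3
  exact (mul_eq_zero.1 h4).resolve_left (mul_pos two_pos (hatPi_pos p i)).ne'

/-- `symPart` as a continuous linear map. -/
def symPartL : Mat n →L[ℝ] Mat n :=
  LinearMap.toContinuousLinearMap
    { toFun := symPart
      map_add' := fun X Y => by funext i j; simp [symPart, tr]; ring
      map_smul' := fun c X => by funext i j; simp [symPart, tr]; ring }

lemma symPartL_apply (X : Mat n) : symPartL X = symPart X := rfl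

/-- `outerSym p` as a continuous linear map. -/
def outerSymL (p : PosProb n) : (Fin n → ℝ) →L[ℝ] Mat n :=
  LinearMap.toContinuousLinearMap
    { toFun := outerSym p
      map_add' := fun a b => by funext i j; simp [outerSym]; ring
      map_smul' := fun c a => by funext i j; simp [outerSym]; ring }

/-- `X ↦ X v` as a continuous linear map. -/
def mulVL (v : Fin n → ℝ) : Mat n →L[ℝ] (Fin n → ℝ) :=
  LinearMap.toContinuousLinearMap
    { toFun := fun X => mulV X v
      map_add' := fun X Y => mulV_add X Y v
      map_smul' := fun c X => mulV_smul c X v }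

lemma mulVL_apply (v : Fin n → ℝ) (X : Mat n) : mulVL v X = mulV X v := rfl

/-- `X ↦ (a ↦ sysMat p X a)` as a continuous linear map into the continuous endomorphisms. -/
def sysL (p : PosProb n) : Mat n →L[ℝ] (Fin n → ℝ) →L[ℝ] (Fin n → ℝ) :=
  LinearMap.toContinuousLinearMap
    ((LinearMap.toContinuousLinearMap :
      ((Fin n → ℝ) →ₗ[ℝ] (Fin n → ℝ)) ≃ₗ[ℝ] _).toLinearMap ∘ₗ
      LinearMap.mk₂ ℝ (fun X a => (sysMat p X).mulVec a)
        (fun X Y a => by simp only [sysMat_mulVec, mul_add, mulV_add])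
        (fun c X a => by simp only [sysMat_mulVec, mul_smul_comm, mulV_smul])
        (fun X a b => Matrix.mulVec_add _ _ _)
        (fun c X a => Matrix.mulVec_smul _ _ _))

lemma sysL_apply (p : PosProb n) (X : Mat n) (a : Fin n → ℝ) :
    sysL p X a = (sysMat p X).mulVec a := rfl

/-- The system at a point of `M_π` as a continuous linear equivalence. -/
def sysEquiv {p : PosProb n} (S : RevMan p) : (Fin n → ℝ) ≃L[ℝ] (Fin n → ℝ) :=
  ContinuousLinearEquiv.equivOfInverse (sysL p S.mat)
    (LinearMap.toContinuousLinearMap (Matrix.mulVecLin (sysMat p S.mat)⁻¹))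
    (fun a => by simp [sysL_apply, Matrix.nonsing_inv_mul _ (isUnit_det_sysMat S)])
    (fun a => by simp [sysL_apply, Matrix.mul_nonsing_inv _ (isUnit_det_sysMat S)])

lemma coe_sysEquiv {p : PosProb n} (S : RevMan p) :
    (sysEquiv S : (Fin n → ℝ) →L[ℝ] (Fin n → ℝ)) = sysL p S.mat := rfl

/-! ### The Riemannian gradient -/

lemma fisherForm_mul_self {S : Mat n} (hS : ∀ i j, S i j ≠ 0) (X Y : Mat n) :
    fisherForm S (X * S) Y = ∑ i, ∑ j, X i j * Y i j := by
  rw [fisherForm_apply]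
  refine Finset.sum_congr rfl fun i _ => Finset.sum_congr rfl fun j _ => ?_
  have := hS i j
  simp; field_simp

/-- The matrices `(a π̂ᵀ + π̂ aᵀ) ⊙ S` are normal to `M_π`, because tangent vectors
annihilate `π̂`. -/
lemma fisherForm_outerSym_mul {p : PosProb n} (S : RevMan p) (a : Fin n → ℝ) (η : TSpace S) :
    fisherForm S.mat (outerSym p a * S.mat) (tmat η) = 0 := by
  have hη : ∀ i j, tmat η j i = tmat η i j := fun i j => congrFun (congrFun (Subtype.prop η).1 i) j
  have hη0 : ∀ i, ∑ j, tmat η i j * hatPi p j = 0 := fun i => congrFun (Subtype.prop η).2 i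
  rw [fisherForm_mul_self fun i j => (S.pos i j).ne']
  simp only [outerSym, add_mul, Finset.sum_add_distrib]
  have h1 : ∑ i, ∑ j, a i * hatPi p j * tmat η i j = 0 :=
    Finset.sum_eq_zero fun i _ => by
      rw [← mul_zero (a i), ← hη0 i, Finset.mul_sum]
      exact Finset.sum_congr rfl fun j _ => by ring
  have h2 : ∑ i, ∑ j, hatPi p i * a j * tmat η i j = 0 := by
    rw [← h1, Finset.sum_comm]
    refine Finset.sum_congr rfl fun i _ => Finset.sum_congr rfl fun j _ => ?_
    rw [hη i j]; ring
  rw [h1, h2, add_zero]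

lemma tr_symPart (X : Mat n) : tr (symPart X) = symPart X := by
  funext i j; simp [symPart, tr]; ring

/-- The Fisher projection of `Z` computed from the solution `a` of the linear system: the right-hand
side is tangent, and differs from `symPart Z` by a normal matrix. -/
lemma tmat_fisherProj {p : PosProb n} {S : RevMan p} {Z : Mat n} {a : Fin n → ℝ}
    (ha : (sysMat p S.mat).mulVec a = mulV (symPart Z) (hatPi p)) :
    tmat (fisherProj S Z) = symPart Z - outerSym p a * S.mat := by
  have hmem : symPart Z - outerSym p a * S.mat ∈ tangentModel p := by
    constructor
    · have hS : ∀ i j, S.mat j i = S.mat i j := fun i j => congrFun (congrFun S.symm i) j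
      have hZ : ∀ i j, symPart Z j i = symPart Z i j := fun i j =>
        congrFun (congrFun (tr_symPart Z) i) j
      funext i j
      simp only [tr, Pi.sub_apply, Pi.mul_apply, outerSym, hS i j, hZ i j]
      ring
    · rw [mulV_sub, ← sysMat_mulVec, ha, sub_self]
  let ζ : TSpace S := (⟨_, hmem⟩ : tangentModel p)
  have hζ : tmat ζ = symPart Z - outerSym p a * S.mat := rfl
  rw [← hζ]
  congr 1
  refine fisherProj_eq_iff.2 fun η => ?_
  rw [hζ, map_sub, FunLike.coe_sub, Pi.sub_apply, fisherForm_outerSym_mul, sub_zero,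
    fisherForm_symPart]

lemma riemGrad_eq {p : PosProb n} {f : RevMan p → ℝ} {F : Mat n → ℝ}
    (hFf : ∀ S : RevMan p, F S.mat = f S) {S : RevMan p} (hF : DifferentiableAt ℝ F S.mat) :
    riemGrad f S = fisherProj S (gam F S) := by
  have hf : f = F ∘ RevMan.mat := funext fun T => (hFf T).symm
  have hd : mderiv f S = (fderiv ℝ F S.mat).comp (TModel.incl p) := by
    refine mderiv_eq ?_
    rw [hf]
    refine HasFDerivAt.comp (g := F) _ ?_ (hasFDerivAt_mat_chartInv S)
    simpa [chartInv_globalChart] using hF.hasFDerivAt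
  refine ext_inner_right ℝ fun η => ?_
  rw [inner_fisherProj, gam, fisherForm_mul_self fun i j => (S.pos i j).ne', euclGrad_spec]
  refine (inner_fisherDual _ η).trans ?_
  exact congrArg (fun L : TModel p →L[ℝ] ℝ => L η) hd

/-! ### Derivatives of the data -/

lemma differentiableAt_euclGrad {F : Mat n → ℝ} {X : Mat n} (hF : ContDiffAt ℝ ∞ F X) :
    DifferentiableAt ℝ (euclGrad F) X := by
  have h : DifferentiableAt ℝ (fderiv ℝ F) X :=
    (hF.fderiv_right (m := 1) (by norm_cast)).differentiableAt one_ne_zero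
  exact differentiableAt_pi.2 fun i => differentiableAt_pi.2 fun j =>
    h.clm_apply (differentiableAt_const _)

lemma hasFDerivAt_comp_mat_chartInv {p : PosProb n} {W : Type*} [NormedAddCommGroup W]
    [NormedSpace ℝ W] {G : Mat n → W} {S : RevMan p} (hG : DifferentiableAt ℝ G S.mat) :
    HasFDerivAt ((G ∘ RevMan.mat) ∘ chartInv p) ((fderiv ℝ G S.mat).comp (TModel.incl p))
      (globalChart p S) := by
  refine HasFDerivAt.comp (g := G) _ ?_ (hasFDerivAt_mat_chartInv S)
  simpa [chartInv_globalChart] using hG.hasFDerivAt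

lemma hasFDerivAt_gam {p : PosProb n} {F : Mat n → ℝ} {S : RevMan p}
    (hF : ContDiffAt ℝ ∞ F S.mat) :
    HasFDerivAt (gam F ∘ chartInv p)
      (euclGrad F S.mat • TModel.incl p +
        S.mat • (fderiv ℝ (euclGrad F) S.mat).comp (TModel.incl p)) (globalChart p S) := by
  have h := (hasFDerivAt_comp_mat_chartInv (differentiableAt_euclGrad hF)).mul
    (hasFDerivAt_mat_chartInv S)
  simp only [Function.comp_apply, chartInv_globalChart] at h
  exact h

/-- The solution of the system depends differentiably on the point: it is the image of a
differentiable right-hand side under the inverse of `sysL p S`, and inversion is smooth at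
equivalences. -/
lemma differentiableAt_of_system {p : PosProb n} {g : RevMan p → Mat n}
    {α : RevMan p → Fin n → ℝ}
    (hα : ∀ S, (sysMat p S.mat).mulVec (α S) = mulV (symPart (g S)) (hatPi p))
    {S : RevMan p}
    (hg : DifferentiableAt ℝ (g ∘ chartInv p) (globalChart p S)) :
    DifferentiableAt ℝ (α ∘ chartInv p) (globalChart p S) := by
  have heq : α ∘ chartInv p = fun v =>
      ((sysL p ((RevMan.mat ∘ chartInv p) v)).inverse)
        (mulVL (hatPi p) (symPartL ((g ∘ chartInv p) v))) := by
    funext v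
    rw [Function.comp_apply, Function.comp_apply, Function.comp_apply, symPartL_apply, mulVL_apply,
      ← hα, ← sysL_apply, ← coe_sysEquiv, ContinuousLinearMap.inverse_equiv]
    exact ((sysEquiv (chartInv p v)).symm_apply_apply _).symm
  rw [heq]
  have hinv : DifferentiableAt ℝ ContinuousLinearMap.inverse
      (sysL p ((RevMan.mat ∘ chartInv p) (globalChart p S))) := by
    rw [Function.comp_apply, chartInv_globalChart, ← coe_sysEquiv]
    exact (contDiffAt_map_inverse (n := 1) (sysEquiv S)).differentiableAt one_ne_zero
  have h1 := (sysL p).differentiableAt.comp _ (hasFDerivAt_mat_chartInv S).differentiableAt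
  have h2 := (mulVL (hatPi p)).differentiableAt.comp _ (symPartL.differentiableAt.comp _ hg)
  exact (DifferentiableAt.comp (g := ContinuousLinearMap.inverse)
    (f := sysL p ∘ RevMan.mat ∘ chartInv p) _ hinv h1).clm_apply h2

/-- The linear system for the derivative of `α`, by differentiating the system for `α`. -/
lemma system_mderiv {p : PosProb n} {g : RevMan p → Mat n}
    {α : RevMan p → Fin n → ℝ}
    (hα : ∀ S, (sysMat p S.mat).mulVec (α S) = mulV (symPart (g S)) (hatPi p))
    {S : RevMan p}
    (hg : MDifferentiableAt 𝓘(ℝ, TModel p) 𝓘(ℝ, Mat n) g S)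
    (hα' : MDifferentiableAt 𝓘(ℝ, TModel p) 𝓘(ℝ, Fin n → ℝ) α S) (ξ : TModel p) :
    (sysMat p S.mat).mulVec (mderiv α S ξ) =
      mulV (symPart (mderiv g S ξ)) (hatPi p) -
        (sysMat p (TModel.incl p ξ)).mulVec (α S) := by
  have h1 := ((sysL p).hasFDerivAt.comp _ (hasFDerivAt_mat_chartInv S)).clm_apply
    (hasFDerivAt_mderiv hα')
  have h2 := (mulVL (hatPi p)).hasFDerivAt.comp _
    (symPartL.hasFDerivAt.comp _ (hasFDerivAt_mderiv hg))
  have heq : (fun v => (sysL p ∘ RevMan.mat ∘ chartInv p) v ((α ∘ chartInv p) v)) =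
      (mulVL (hatPi p)) ∘ symPartL ∘ g ∘ chartInv p :=
    funext fun v => hα (chartInv p v)
  rw [heq] at h1
  have h := congrArg (fun L : TModel p →L[ℝ] (Fin n → ℝ) => L ξ) (h1.unique h2)
  simp [chartInv_globalChart] at h
  exact eq_sub_of_add_eq h

lemma hasFDerivAt_symPart_sub_outerSym {p : PosProb n} {g : RevMan p → Mat n}
    {α : RevMan p → Fin n → ℝ} {S : RevMan p}
    (hg : MDifferentiableAt 𝓘(ℝ, TModel p) 𝓘(ℝ, Mat n) g S)
    (hα : MDifferentiableAt 𝓘(ℝ, TModel p) 𝓘(ℝ, Fin n → ℝ) α S) :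
    HasFDerivAt ((fun T : RevMan p => symPart (g T) - outerSym p (α T) * T.mat) ∘ chartInv p)
      (symPartL.comp (mderiv g S) - (outerSym p (α S) • TModel.incl p +
        S.mat • (outerSymL p).comp (mderiv α S))) (globalChart p S) := by
  have h := (symPartL.hasFDerivAt.comp _ (hasFDerivAt_mderiv hg)).sub
    (((outerSymL p).hasFDerivAt.comp _ (hasFDerivAt_mderiv hα)).mul (hasFDerivAt_mat_chartInv S))
  simp only [Function.comp_apply, chartInv_globalChart] at h
  exact h

/-- `TModel p` is complemented in the matrices, so differentiability can be tested there. -/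
lemma differentiableAt_of_incl {p : PosProb n} {E : Type*} [NormedAddCommGroup E] [NormedSpace ℝ E]
    {g : E → TModel p} {x : E} (h : DifferentiableAt ℝ (fun v => TModel.incl p (g v)) x) :
    DifferentiableAt ℝ g x := by
  obtain ⟨P, hP⟩ := Submodule.ClosedComplemented.of_finiteDimensional (tangentModel p)
  have heq : g = fun v => (P (TModel.incl p (g v)) : TModel p) := funext fun v => (hP (g v)).symm
  rw [heq]
  exact P.differentiableAt.comp x h

lemma dirDeriv_tmat {p : PosProb n} {σ : ∀ S : RevMan p, TSpace S} {S : RevMan p}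
    (hσ : MDifferentiableAt 𝓘(ℝ, TModel p) 𝓘(ℝ, TModel p) (sect σ) S) (ξ : TSpace S) :
    dirDeriv (fun T => tmat (σ T)) S ξ = tmat (flatConn p σ S ξ) := by
  have h : mderiv (fun T => tmat (σ T)) S = (TModel.incl p).comp (mderiv (sect σ) S) :=
    mderiv_eq ((TModel.incl p).hasFDerivAt.comp _ (hasFDerivAt_mderiv hσ))
  exact congrArg (fun L : TModel p →L[ℝ] Mat n => L ξ) h

end ReversibleManifold

end

/-! ### The Hessian formula -/

open ReversibleManifold in
theorem mainTheorem8 {n : ℕ} (p : PosProb n) (f : RevMan p → ℝ)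
    (U : Set (Mat n)) (hU : IsOpen U) (hMU : ∀ S : RevMan p, S.mat ∈ U)
    (F : Mat n → ℝ) (hF : ContDiffOn ℝ ∞ F U) (hFf : ∀ S : RevMan p, F S.mat = f S) :
    -- the Levi-Civita connection exists
    (∃ conn, IsLeviCivita (p := p) conn) ∧
    -- the systems are nonsingular
    (∀ S : RevMan p, IsUnit (sysMat p S.mat).det) ∧
    ∀ α : RevMan p → Fin n → ℝ,
      (∀ S, (sysMat p S.mat).mulVec (α S) = mulV (symPart (gam F S)) (hatPi p)) →
      ∀ (S : RevMan p) (ξ : TSpace S),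
        -- the maps that are differentiated below are differentiable
        MDifferentiableAt 𝓘(ℝ, TModel p) 𝓘(ℝ, Mat n) (gam (p := p) F) S ∧
        MDifferentiableAt 𝓘(ℝ, TModel p) 𝓘(ℝ, Fin n → ℝ) α S ∧
        MDifferentiableAt 𝓘(ℝ, TModel p) 𝓘(ℝ, Mat n) (fun T => tmat (riemGrad f T)) S ∧
        MDifferentiableAt 𝓘(ℝ, TModel p) (𝓘(ℝ, TModel p).prod 𝓘(ℝ, TModel p))
          (fun T => (⟨T, riemGrad f T⟩ : TangentBundle 𝓘(ℝ, TModel p) (RevMan p))) S ∧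
        -- the derivative of `γ`
        dirDeriv (gam F) S ξ = euclHess F S.mat (tmat ξ) * S.mat + euclGrad F S.mat * tmat ξ ∧
        -- the linear system for the derivative of `α`
        (sysMat p S.mat).mulVec (dirDeriv α S ξ) =
          mulV (symPart (dirDeriv (gam F) S ξ)) (hatPi p) -
            (sysMat p (tmat ξ)).mulVec (α S) ∧
        -- the derivative of the Riemannian gradient
        dirDeriv (fun T => tmat (riemGrad f T)) S ξ =
          symPart (dirDeriv (gam F) S ξ) - outerSym p (dirDeriv α S ξ) * S.mat -
            outerSym p (α S) * tmat ξ ∧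
        -- its projection can be computed without symmetrising the derivative of `γ`
        projTilde S (dirDeriv (fun T => tmat (riemGrad f T)) S ξ) =
          projTilde S (dirDeriv (gam F) S ξ - outerSym p (dirDeriv α S ξ) * S.mat -
            outerSym p (α S) * tmat ξ) ∧
        -- the Riemannian Hessian
        ∀ conn, IsLeviCivita (p := p) conn →
          riemHess conn f S ξ =
            projTilde S (dirDeriv (fun T => tmat (riemGrad f T)) S ξ) -
              (1 / 2 : ℝ) • projTilde S
                ((tmat (projTilde S (euclGrad F S.mat * S.mat)) * tmat ξ) / S.mat) := by
  have hFat : ∀ S : RevMan p, ContDiffAt ℝ ∞ F S.mat := fun S =>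
    hF.contDiffAt (hU.mem_nhds (hMU S))
  have hgrad : ∀ S : RevMan p, riemGrad f S = fisherProj S (gam F S) := fun S =>
    riemGrad_eq hFf ((hFat S).differentiableAt (by simp))
  refine ⟨⟨fisherConn p, isLeviCivita_fisherConn p⟩, isUnit_det_sysMat, fun α hα S ξ => ?_⟩
  have hγ : MDifferentiableAt 𝓘(ℝ, TModel p) 𝓘(ℝ, Mat n) (gam (p := p) F) S :=
    mdifferentiableAt_iff_differentiableAt.2 (hasFDerivAt_gam (hFat S)).differentiableAt
  have hα' : MDifferentiableAt 𝓘(ℝ, TModel p) 𝓘(ℝ, Fin n → ℝ) α S :=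
    mdifferentiableAt_iff_differentiableAt.2
      (differentiableAt_of_system hα (hasFDerivAt_gam (hFat S)).differentiableAt)
  have hmat : (fun T => tmat (riemGrad f T)) =
      fun T : RevMan p => symPart (gam F T) - outerSym p (α T) * T.mat :=
    funext fun T => by rw [hgrad, tmat_fisherProj (hα T)]
  have hgrad' := hasFDerivAt_symPart_sub_outerSym hγ hα'
  rw [← hmat] at hgrad'
  have hsec : MDifferentiableAt 𝓘(ℝ, TModel p) 𝓘(ℝ, TModel p) (sect (riemGrad f)) S :=
    mdifferentiableAt_iff_differentiableAt.2 (differentiableAt_of_incl hgrad'.differentiableAt)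
  have hD : dirDeriv (fun T => tmat (riemGrad f T)) S ξ =
      symPart (dirDeriv (gam F) S ξ) - outerSym p (dirDeriv α S ξ) * S.mat -
        outerSym p (α S) * tmat ξ := by
    refine (congrArg (fun L : TModel p →L[ℝ] Mat n => L ξ) (mderiv_eq hgrad')).trans ?_
    refine Eq.trans ?_ (sub_sub _ _ _).symm
    rw [add_comm, mul_comm]
    rfl
  refine ⟨hγ, hα', mdifferentiableAt_iff_differentiableAt.2 hgrad'.differentiableAt,
    mdifferentiableAt_section_iff.2 hsec, ?_, system_mderiv hα hγ hα' ξ, hD, ?_, ?_⟩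
  · refine (congrArg (fun L : TModel p →L[ℝ] Mat n => L ξ)
      (mderiv_eq (hasFDerivAt_gam (hFat S)))).trans ?_
    rw [add_comm, mul_comm]
    rfl
  · rw [hD]
    refine ext_inner_right ℝ fun η => ?_
    simp only [projTilde_eq_fisherProj, inner_fisherProj, map_sub, FunLike.coe_sub, Pi.sub_apply,
      fisherForm_symPart]
  · intro conn hconn
    have hconn' := hconn.eq_fisherConn (mdifferentiableAt_section_iff.2 hsec)
    rw [riemHess, hconn', fisherConn_apply, dirDeriv_tmat hsec, christoffel_apply, neg_smul,
      ← sub_eq_add_neg]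
    simp only [projTilde_eq_fisherProj, fisherProj_tmat]
    rw [hgrad]
    rfl
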